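/- Let $\ell^2=\ell^2(\mathbb N)$ be the real Hilbert space of square-summable sequences. Agents $1,\dots,m$ are the vertices of a connected undirected graph $\mathcal G$; agent $i$ holds a convex, twice differentiable loss $f_i:\ell^2\to\mathbb R$, and $f=\frac1m\sum_{i=1}^m f_i$. The losses are $\beta$-similar if $\|\nabla^2 f_i(x)-\nabla^2 f(x)\|\le\beta$ for all $i$ and $x$. A gossip matrix over $\mathcal G$ is a doubly stochastic $W\in\mathbb R^{m\times m}$ with $w_{ii}>0$, with $w_{ij}>0$ if $\{i,j\}$ is an edge and $w_{ij}=0$ if $i\ne j$ and $\{i,j\}$ is not an edge; its parameter is the spectral norm $\|W-\frac1m\mathbf 1\mathbf 1^\top\|$. A distributed oracle algorithm works as follows. Agent $i$ has a memory $\mathcal M_i$, initially $\{0\}$. Before the first, between any two, and after the last communication round, it adds to $\mathcal M_i$, one after the other, finitely many points $x$, each satisfying, for some $\tau_1,\tau_2\ge 0$ with $\tau_1+\tau_2>0$, $$\tau_1x+\tau_2\nabla f_i(x)\in\operatorname{span}\bigl\{x',\ \nabla f_i(x'),\ (\nabla^2f_i(x')+D)x'',\ (\nabla^2f_i(x')+D)^{-1}x''\bigr\},$$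 where $x',x''$ range over the current $\mathcal M_i$ and $D$ over the bounded diagonal operators on $\ell^2$ (inverses are used only when $\nabla^2f_i(x')+D$ is boundedly invertible). In a communication round, every $\mathcal M_i$ is replaced by the span of the union of $\mathcal M_i$ and the memories $\mathcal M_j$ of all neighbours $j$ of $i$. At the end agent $i$ outputs some $x_i\in\mathcal M_i$. **Theorem.** There are absolute constants $c,a>0$ such that for all $\mu\in(0,1)$, $\beta\in(0,1)$ and $\rho\in[0,1)$ there exist: an integer $m\ge2$; a graph $\mathcal G$ on $m$ vertices that is a path or a triangle; a gossip matrix $W$ over $\mathcal G$ with parameter exactly $\rho$; and convex, twice differentiable, $\beta$-similar losses $f_1,\dots,f_m$ on $\ell^2$ such that $f$ is $1$-smooth and $\mu$-strongly convex with minimizer $x^\star\neq0$, with the following property. For every $\varepsilon$ with $0<\varepsilon\le a\,\mu\|x^\star\|^2$, every distributed oracle algorithm over $\mathcal G$ whose outputs satisfy $f(x_i)-f(x^\star)\le\varepsilon$ for all agents $i$ uses a number $N$ of communication rounds with $$N\ \ge\ c\,\sqrt{\frac{\min\{\beta,\,1-\mu\}/\mu}{1-\rho}}\;\log\!\left(\frac{\mu\|x^\star\|^2}{\varepsilon}\right).$$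 In particular $N=\Omega\Bigl(\sqrt{\tfrac{\beta/\mu}{1-\rho}}\,\log\tfrac{\mu\|x^\star\|^2}{\varepsilon}\Bigr)$ with an absolute constant whenever $\beta\le 1-\mu$, and also whenever $\mu\le\frac12$; for arbitrary $\mu,\beta$ the constant is at least $c\sqrt{1-\mu}$. -/

import Mathlib

noncomputable section

namespace DistOpt

/-- The real sequence space `ℓ²(ℕ)`. -/
abbrev Ell2 : Type := lp (fun _ : ℕ => ℝ) 2

/-- The Hessian `∇² f x`, as a continuous linear operator on `ℓ²`. -/
def hessian (f : Ell2 → ℝ) (x : Ell2) : Ell2 →L[ℝ] Ell2 :=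
  fderiv ℝ (gradient f) x

/-- A bounded operator on `ℓ²` that is diagonal in the standard basis. -/
def IsDiagonal (D : Ell2 →L[ℝ] Ell2) : Prop :=
  ∃ d : ℕ → ℝ, ∀ (x : Ell2) (k : ℕ), D x k = d k * x k

/-- The average loss `f = (1/m) ∑ᵢ fᵢ`. -/
def avg {m : ℕ} (f : Fin m → Ell2 → ℝ) (x : Ell2) : ℝ :=
  (1 / (m : ℝ)) * ∑ i, f i x

/-- `β`-similarity: `‖∇² fᵢ x - ∇² f x‖ ≤ β` (operator norm) for all agents `i` and points `x`. -/
def Similar {m : ℕ} (β : ℝ) (f : Fin m → Ell2 → ℝ) : Prop :=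
  ∀ (i : Fin m) (x : Ell2), ‖hessian (f i) x - hessian (avg f) x‖ ≤ β

/-- The class of smooth problems (no nonsmooth term): every local loss is convex and twice
differentiable, and their average is `μ`-strongly convex and `L`-smooth. -/
structure ProblemClass {m : ℕ} (μ : ℝ) (L : NNReal) (f : Fin m → Ell2 → ℝ) : Prop where
  convex : ∀ i, ConvexOn ℝ Set.univ (f i)
  differentiable : ∀ i, Differentiable ℝ (f i)
  twice_differentiable : ∀ i, Differentiable ℝ (gradient (f i))
  strongly_convex : StrongConvexOn Set.univ μ (avg f)
  smooth : LipschitzWith L (gradient (avg f))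

/-- A gossip matrix over the graph `G`: positive diagonal, off-diagonal entries positive exactly on
the edges of `G` and zero elsewhere, doubly stochastic. -/
structure IsGossip {m : ℕ} (G : SimpleGraph (Fin m)) (W : Matrix (Fin m) (Fin m) ℝ) : Prop where
  diag_pos : ∀ i, 0 < W i i
  edge_pos : ∀ i j, G.Adj i j → 0 < W i j
  nonedge : ∀ i j, i ≠ j → ¬ G.Adj i j → W i j = 0
  row_sum : ∀ i, ∑ j, W i j = 1
  col_sum : ∀ j, ∑ i, W i j = 1

/-- The network parameter `‖W - 11ᵀ/m‖` (spectral norm). -/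
def gossipParam {m : ℕ} (W : Matrix (Fin m) (Fin m) ℝ) : ℝ :=
  ‖Matrix.toEuclideanCLM (n := Fin m) (𝕜 := ℝ) (W - Matrix.of fun _ _ => 1 / (m : ℝ))‖

/-- The vectors whose linear combinations an agent with loss `fi` and memory `M` may use: `x'`,
`∇ fi x'`, `(∇² fi x' + D) x''`, and `(∇² fi x' + D)⁻¹ x''` whenever that inverse exists, for
`x', x'' ∈ M` and `D` diagonal. -/
inductive OracleVector (fi : Ell2 → ℝ) (M : Set Ell2) : Ell2 → Prop
  | point (x' : Ell2) (hx' : x' ∈ M) : OracleVector fi M x'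
  | grad (x' : Ell2) (hx' : x' ∈ M) : OracleVector fi M (gradient fi x')
  | hess (x' x'' : Ell2) (hx' : x' ∈ M) (hx'' : x'' ∈ M) (D : Ell2 →L[ℝ] Ell2)
      (hD : IsDiagonal D) : OracleVector fi M ((hessian fi x' + D) x'')
  | hessInv (x' x'' : Ell2) (hx' : x' ∈ M) (hx'' : x'' ∈ M) (D : Ell2 →L[ℝ] Ell2)
      (hD : IsDiagonal D) (hinv : IsUnit (hessian fi x' + D)) :
      OracleVector fi M (Ring.inverse (hessian fi x' + D) x'')

/-- The points that an agent with loss `fi` and memory `M` may compute in one local step. -/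
def Computable (fi : Ell2 → ℝ) (M : Set Ell2) (x : Ell2) : Prop :=
  ∃ τ₁ τ₂ : ℝ, 0 ≤ τ₁ ∧ 0 ≤ τ₂ ∧ 0 < τ₁ + τ₂ ∧
    τ₁ • x + τ₂ • gradient fi x ∈ Submodule.span ℝ {v | OracleVector fi M v}

/-- One local step: one computable point is added to the memory. -/
def LocalStep (fi : Ell2 → ℝ) (M M' : Set Ell2) : Prop :=
  ∃ x, Computable fi M x ∧ M' = insert x M

/-- A local phase: finitely many local steps, each using the memory built so far. -/
def LocalPhase (fi : Ell2 → ℝ) : Set Ell2 → Set Ell2 → Prop :=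
  Relation.ReflTransGen (LocalStep fi)

/-- One communication round: the new memory of agent `i` is the span of its own memory together
with those of its neighbours. -/
def communicate {m : ℕ} (G : SimpleGraph (Fin m)) (M : Fin m → Set Ell2) (i : Fin m) : Set Ell2 :=
  (Submodule.span ℝ (⋃ j ∈ {j : Fin m | j = i ∨ G.Adj i j}, M j) : Submodule ℝ Ell2)

/-- `Produces G f N x`: some run of a distributed oracle algorithm over `G` with local losses `f`
and exactly `N` communication rounds ends with the outputs `x i`. Here `A t i` and `B t i` are the
memories of agent `i` after `t` rounds, before and after its local phase. -/
def Produces {m : ℕ} (G : SimpleGraph (Fin m)) (f : Fin m → Ell2 → ℝ) (N : ℕ)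
    (x : Fin m → Ell2) : Prop :=
  ∃ A B : ℕ → Fin m → Set Ell2,
    (∀ i, A 0 i = {0}) ∧
    (∀ t ≤ N, ∀ i, LocalPhase (f i) (A t i) (B t i)) ∧
    (∀ t < N, ∀ i, A (t + 1) i = communicate G (B t) i) ∧
    ∀ i, x i ∈ B N i

end DistOpt

end

/-! The average loss is a tridiagonal quadratic on `ℓ²`: `μ` times the identity plus `γ` times the
couplings of consecutive coordinates, with a linear term along the coordinate `0`. Its minimizer is
a geometric sequence `qⁿ` (`chainOp_geomSeq`). The couplings `{2j+1, 2j+2}` and the linear term are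
held by agents at one end of a path, the couplings `{2j, 2j+1}` by agents at the other end.

Every local Hessian is thus block diagonal with blocks of size at most two. Adding a diagonal
operator, inverting, or taking an implicit step preserves this structure, so local work can at most
complete blocks already touched (`computable_mem_supportedIn`). Each further coordinate costs a trip
across the `2k+1` edges between the two groups (`produces_chainLoss_mem`). After `N` rounds the
output of the far-end agent vanishes from some coordinate `K ≤ 2N/(2k+1)` on, and strong convexity
leaves a gap of at least `(μ/2) q^(2K) ‖x⋆‖²`.

The rate comes from three estimates: similarity and smoothness allow `γ` of order `min β (1 - μ)`;
`-log q ≤ √(μ/γ)` (`exists_decay_rate`); and a path of length at least of order `1/√(1-ρ)` carries a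
gossip matrix of parameter exactly `ρ` (`exists_isGossip_pathGraph`). For the latter, the parameter
of `I - θL` is at least `1` at `θ = 0`, falls to `ρ` or below by a Poincaré inequality, and is
continuous in `θ`. Paths suffice for all `ρ`; the triangle is not needed. -/

noncomputable section

namespace DistOpt

/-! ### Gossip matrices of prescribed parameter on paths -/

section Network

open Finset Matrix

variable {m : ℕ}

/-- The matrix `I - θ L` with `L` the graph Laplacian is a gossip matrix for small `θ > 0`. -/
theorem isGossip_one_sub_smul_lapMatrix (G : SimpleGraph (Fin m)) [DecidableRel G.Adj] {θ : ℝ}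
    (h0 : 0 < θ) (hdeg : ∀ i, θ * G.degree i < 1) :
    IsGossip G (1 - θ • G.lapMatrix ℝ) := by
  have row : ∀ i, ∑ j, (1 - θ • G.lapMatrix ℝ) i j = 1 := by
    intro i
    have h := congrFun (G.lapMatrix_mulVec_const_eq_zero (R := ℝ)) i
    simp only [mulVec, dotProduct, mul_one, Pi.zero_apply] at h
    simp [sum_sub_distrib, ← mul_sum, h, Matrix.one_apply]
  refine ⟨fun i => ?_, fun i j hij => ?_, fun i j hne hij => ?_, row, fun j => ?_⟩
  · have := hdeg i
    simp [SimpleGraph.lapMatrix, SimpleGraph.degMatrix, SimpleGraph.adjMatrix_apply, this]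
  · simp [SimpleGraph.lapMatrix, SimpleGraph.degMatrix, SimpleGraph.adjMatrix_apply, hij,
      hij.ne, h0]
  · simp [SimpleGraph.lapMatrix, SimpleGraph.degMatrix, SimpleGraph.adjMatrix_apply, hij,
      hne]
  · rw [← row j]
    refine sum_congr rfl fun i _ => ?_
    have h := (G.isSymm_lapMatrix (R := ℝ)).apply i j
    simp only [Matrix.sub_apply, Matrix.smul_apply, h, Matrix.one_apply, eq_comm]

/-- The Dirichlet form of a graph, each edge being counted twice. -/
def dirichlet (G : SimpleGraph (Fin m)) [DecidableRel G.Adj] (x : Fin m → ℝ) : ℝ :=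
  ∑ i, ∑ j, if G.Adj i j then (x i - x j) ^ 2 else 0

theorem lapMatrix_mulVec_eq_sum (G : SimpleGraph (Fin m)) [DecidableRel G.Adj] (x : Fin m → ℝ)
    (i : Fin m) : (G.lapMatrix ℝ *ᵥ x) i = ∑ j, if G.Adj i j then x i - x j else 0 := by
  rw [SimpleGraph.lapMatrix_mulVec_apply, G.degree_eq_sum_if_adj i, sum_mul,
    SimpleGraph.neighborFinset_eq_filter, sum_filter, ← sum_sub_distrib]
  refine sum_congr rfl fun j _ => ?_
  split_ifs <;> simp

theorem sum_mul_lapMatrix_mulVec (G : SimpleGraph (Fin m)) [DecidableRel G.Adj] (x : Fin m → ℝ) :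
    ∑ i, x i * (G.lapMatrix ℝ *ᵥ x) i = dirichlet G x / 2 := by
  rw [dirichlet, ← G.lapMatrix_toLinearMap₂' ℝ x, toLinearMap₂'_apply']
  rfl

/-- Cauchy–Schwarz at each vertex, over its at most `Δ` incident edges. -/
theorem sum_sq_lapMatrix_mulVec_le (G : SimpleGraph (Fin m)) [DecidableRel G.Adj] {Δ : ℕ}
    (hΔ : ∀ i, G.degree i ≤ Δ) (x : Fin m → ℝ) :
    ∑ i, (G.lapMatrix ℝ *ᵥ x) i ^ 2 ≤ Δ * dirichlet G x := by
  rw [dirichlet, mul_sum]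
  refine sum_le_sum fun i _ => ?_
  rw [lapMatrix_mulVec_eq_sum, ← sum_filter, ← sum_filter, ← SimpleGraph.neighborFinset_eq_filter]
  refine sq_sum_le_card_mul_sum_sq.trans ?_
  rw [SimpleGraph.card_neighborFinset_eq_degree]
  gcongr
  exact hΔ i

theorem degree_pathGraph_le [DecidableRel (SimpleGraph.pathGraph m).Adj] (i : Fin m) :
    (SimpleGraph.pathGraph m).degree i ≤ 2 := by
  rw [← SimpleGraph.card_neighborFinset_eq_degree, ← card_map Fin.valEmbedding]
  refine (card_le_card (t := {i.val - 1, i.val + 1}) fun n hn => ?_).trans card_le_two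
  simp only [mem_map, SimpleGraph.mem_neighborFinset, SimpleGraph.pathGraph_adj,
    Fin.valEmbedding_apply] at hn
  obtain ⟨j, hj, rfl⟩ := hn
  simp only [mem_insert, mem_singleton]
  omega

/-- The difference telescopes along the path between the two vertices; Cauchy–Schwarz costs the
number of edges, at most `m`. -/
theorem sq_sub_le_dirichlet_pathGraph [DecidableRel (SimpleGraph.pathGraph m).Adj]
    (x : Fin m → ℝ) (i j : Fin m) :
    (x i - x j) ^ 2 ≤ m * dirichlet (SimpleGraph.pathGraph m) x := by
  wlog hij : i ≤ j generalizing i j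
  · rw [← neg_sub, neg_sq]
    exact this j i (le_of_not_ge hij)
  set y : ℕ → ℝ := fun n => if h : n < m then x ⟨n, h⟩ else 0 with hy
  have hxy : ∀ l : Fin m, x l = y l := fun l => by simp [hy]
  have htel : x j - x i = ∑ l ∈ Ico i.val j.val, (y (l + 1) - y l) := by
    rw [sum_Ico_sub y hij, hxy, hxy]
  rw [← neg_sub, neg_sq, htel]
  refine sq_sum_le_card_mul_sum_sq.trans ?_
  have hsum : ∑ l ∈ Ico i.val j.val, (y (l + 1) - y l) ^ 2
      ≤ dirichlet (SimpleGraph.pathGraph m) x := by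
    have h1 : ∑ l ∈ Ico i.val j.val, (y (l + 1) - y l) ^ 2
        ≤ ∑ l ∈ range m, if l + 1 < m then (y (l + 1) - y l) ^ 2 else 0 := by
      calc ∑ l ∈ Ico i.val j.val, (y (l + 1) - y l) ^ 2
          = ∑ l ∈ Ico i.val j.val, if l + 1 < m then (y (l + 1) - y l) ^ 2 else 0 := by
            refine sum_congr rfl fun l hl => ?_
            rw [if_pos]
            have := mem_Ico.1 hl
            omega
        _ ≤ _ := by
            refine sum_le_sum_of_subset_of_nonneg (fun l hl => ?_) fun l _ _ => ?_
            · have := mem_Ico.1 hl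
              exact mem_range.2 (by omega)
            · split_ifs <;> positivity
    refine h1.trans ?_
    rw [← Fin.sum_univ_eq_sum_range (fun l => if l + 1 < m then (y (l + 1) - y l) ^ 2 else 0) m]
    refine sum_le_sum fun l _ => ?_
    have hnn : ∀ a ∈ (univ : Finset (Fin m)),
        0 ≤ if (SimpleGraph.pathGraph m).Adj l a then (x l - x a) ^ 2 else 0 := by
      intro a _
      split_ifs <;> positivity
    split_ifs with hl
    · refine le_trans (le_of_eq ?_) (single_le_sum hnn (mem_univ (⟨l + 1, hl⟩ : Fin m)))
      rw [if_pos (SimpleGraph.pathGraph_adj.2 (Or.inl rfl)), hxy, hxy]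
      ring
    · exact sum_nonneg hnn
  have hcard : ((Ico i.val j.val).card : ℝ) ≤ m := by
    rw [Nat.card_Ico]
    exact_mod_cast (by omega : j.val - i.val ≤ m)
  exact mul_le_mul hcard hsum (sum_nonneg fun _ _ => sq_nonneg _) (Nat.cast_nonneg _)

/-- A Poincaré inequality on the path. -/
theorem two_mul_sum_sq_le_dirichlet_pathGraph [DecidableRel (SimpleGraph.pathGraph m).Adj]
    (hm : 0 < m) (x : Fin m → ℝ) (hx : ∑ i, x i = 0) :
    2 * ∑ i, x i ^ 2 ≤ (m : ℝ) ^ 2 * dirichlet (SimpleGraph.pathGraph m) x := by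
  have h1 : ∑ i, ∑ j, (x i - x j) ^ 2 = 2 * m * ∑ i, x i ^ 2 := by
    have : ∀ i j, (x i - x j) ^ 2 = x i ^ 2 + x j ^ 2 - 2 * (x i * x j) := fun i j => by ring
    simp only [this, sum_sub_distrib, sum_add_distrib, ← mul_sum, hx, sum_const, card_univ,
      Fintype.card_fin, nsmul_eq_mul, mul_zero]
    ring
  have h2 : ∑ i, ∑ j, (x i - x j) ^ 2
      ≤ ∑ _i : Fin m, ∑ _j : Fin m, m * dirichlet (SimpleGraph.pathGraph m) x :=
    sum_le_sum fun i _ => sum_le_sum fun j _ => sq_sub_le_dirichlet_pathGraph x i j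
  simp only [sum_const, card_univ, Fintype.card_fin, nsmul_eq_mul] at h2
  rw [h1] at h2
  have hm' : (0 : ℝ) < m := by exact_mod_cast hm
  refine le_of_mul_le_mul_left ?_ hm'
  linarith

theorem gossipParam_le {W : Matrix (Fin m) (Fin m) ℝ} {r : ℝ} (hr : 0 ≤ r)
    (h : ∀ x : Fin m → ℝ, ∑ i, ((W - of fun _ _ => 1 / (m : ℝ)) *ᵥ x) i ^ 2
      ≤ r ^ 2 * ∑ i, x i ^ 2) : gossipParam W ≤ r := by
  refine ContinuousLinearMap.opNorm_le_bound _ hr fun x => ?_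
  refine le_of_sq_le_sq ?_ (by positivity)
  rw [mul_pow, EuclideanSpace.real_norm_sq_eq, EuclideanSpace.real_norm_sq_eq]
  simp only [ofLp_toEuclideanCLM]
  exact h _

/-- Only the mean-zero part `y` of `x` survives. With `D` the Dirichlet form, `⟨y, Ly⟩ = D/2` and
`‖Ly‖² ≤ 2D`, so `‖y - Ly/4‖² ≤ ‖y‖² - D/8`, and the Poincaré inequality bounds `D/8` below by
`‖y‖²/(4m²)`. -/
theorem gossipParam_pathGraph_le [DecidableRel (SimpleGraph.pathGraph m).Adj] (hm : 0 < m)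
    {r : ℝ} (hr : 0 ≤ r) (hr2 : 1 - 1 / (4 * (m : ℝ) ^ 2) ≤ r ^ 2) :
    gossipParam (1 - (1 / 4 : ℝ) • (SimpleGraph.pathGraph m).lapMatrix ℝ) ≤ r := by
  refine gossipParam_le hr fun x => ?_
  have hm' : (0 : ℝ) < m := by exact_mod_cast hm
  set a : ℝ := (∑ i, x i) / m with ha
  set y : Fin m → ℝ := fun i => x i - a with hy
  have hsumy : ∑ i, y i = 0 := by
    simp only [hy, sum_sub_distrib, sum_const, card_univ, Fintype.card_fin, nsmul_eq_mul, ha]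
    field_simp
    ring
  have hLy : ∀ i, ((SimpleGraph.pathGraph m).lapMatrix ℝ *ᵥ x) i = ((SimpleGraph.pathGraph m).lapMatrix ℝ *ᵥ y) i := fun i => by
    simp [lapMatrix_mulVec_eq_sum, hy]
  have happly : ∀ i, ((1 - (1 / 4 : ℝ) • (SimpleGraph.pathGraph m).lapMatrix ℝ - of fun _ _ => 1 / (m : ℝ)) *ᵥ x) i
      = y i - 1 / 4 * ((SimpleGraph.pathGraph m).lapMatrix ℝ *ᵥ y) i := by
    intro i
    rw [sub_mulVec, sub_mulVec, one_mulVec, smul_mulVec, Pi.sub_apply, Pi.sub_apply,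
      Pi.smul_apply, hLy, smul_eq_mul]
    have : ((of fun _ _ => 1 / (m : ℝ) : Matrix (Fin m) (Fin m) ℝ) *ᵥ x) i = a := by
      simp [mulVec, dotProduct, ha, ← mul_sum, div_eq_inv_mul]
    rw [this]
    simp only [hy]
    ring
  simp only [happly]
  have hexp : ∑ i, (y i - 1 / 4 * ((SimpleGraph.pathGraph m).lapMatrix ℝ *ᵥ y) i) ^ 2
      = ∑ i, y i ^ 2 - 1 / 2 * ∑ i, y i * ((SimpleGraph.pathGraph m).lapMatrix ℝ *ᵥ y) i
        + 1 / 16 * ∑ i, ((SimpleGraph.pathGraph m).lapMatrix ℝ *ᵥ y) i ^ 2 := by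
    rw [mul_sum, mul_sum, ← sum_sub_distrib, ← sum_add_distrib]
    exact sum_congr rfl fun i _ => by ring
  have hyx : ∑ i, y i ^ 2 ≤ ∑ i, x i ^ 2 := by
    have h1 : ∑ i, x i ^ 2 = ∑ i, y i ^ 2 + 2 * a * ∑ i, y i + m * a ^ 2 := by
      have : ∀ i, x i ^ 2 = y i ^ 2 + 2 * a * y i + a ^ 2 := fun i => by simp only [hy]; ring
      simp only [this, sum_add_distrib, ← mul_sum, sum_const, card_univ, Fintype.card_fin,
        nsmul_eq_mul]
    rw [h1, hsumy]
    nlinarith [mul_nonneg hm'.le (sq_nonneg a)]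
  have h1 := sum_mul_lapMatrix_mulVec (SimpleGraph.pathGraph m) y
  have h2 := sum_sq_lapMatrix_mulVec_le (SimpleGraph.pathGraph m) (Δ := 2) degree_pathGraph_le y
  have h3 := two_mul_sum_sq_le_dirichlet_pathGraph hm y hsumy
  have h4 : 1 / (4 * (m : ℝ) ^ 2) * ∑ i, y i ^ 2 ≤ 1 / 8 * dirichlet (SimpleGraph.pathGraph m) y := by
    rw [div_mul_eq_mul_div, div_le_iff₀ (by positivity)]
    nlinarith
  push_cast at h2
  calc ∑ i, (y i - 1 / 4 * ((SimpleGraph.pathGraph m).lapMatrix ℝ *ᵥ y) i) ^ 2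
      ≤ (1 - 1 / (4 * (m : ℝ) ^ 2)) * ∑ i, y i ^ 2 := by rw [hexp]; linarith
    _ ≤ r ^ 2 * ∑ i, y i ^ 2 :=
        mul_le_mul_of_nonneg_right hr2 (sum_nonneg fun _ _ => sq_nonneg _)
    _ ≤ r ^ 2 * ∑ i, x i ^ 2 := mul_le_mul_of_nonneg_left hyx (sq_nonneg r)

/-- A difference of two basis vectors has mean zero, hence is fixed. -/
theorem one_le_gossipParam_one (hm : 2 ≤ m) : 1 ≤ gossipParam (1 : Matrix (Fin m) (Fin m) ℝ) := by
  let i : Fin m := ⟨0, by omega⟩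
  let j : Fin m := ⟨1, by omega⟩
  have hij : i ≠ j := by simp [i, j]
  set x : EuclideanSpace ℝ (Fin m) := WithLp.toLp 2 (Pi.single i 1 - Pi.single j 1) with hx
  have hx0 : x ≠ 0 := fun h => by
    have := congrArg (fun z : EuclideanSpace ℝ (Fin m) => z i) h
    simp [hx, hij] at this
  have hfix : toEuclideanCLM (n := Fin m) (𝕜 := ℝ) (1 - of fun _ _ => 1 / (m : ℝ)) x = x := by
    have h0 : (of fun _ _ => 1 / (m : ℝ) : Matrix (Fin m) (Fin m) ℝ) *ᵥ
        (Pi.single i 1 - Pi.single j 1) = 0 := by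
      ext l
      simp [mulVec_sub]
    rw [hx, toEuclideanCLM_toLp, sub_mulVec, one_mulVec, h0, sub_zero]
  have hle := ContinuousLinearMap.le_opNorm
    (toEuclideanCLM (n := Fin m) (𝕜 := ℝ) (1 - of fun _ _ => 1 / (m : ℝ))) x
  rw [hfix] at hle
  exact (le_mul_iff_one_le_left (norm_pos_iff.2 hx0)).1 hle

/-- Intermediate values of the network parameter of `I - θ L`. -/
theorem exists_isGossip_of_gossipParam_le (G : SimpleGraph (Fin m)) [DecidableRel G.Adj]
    (hm : 2 ≤ m) {θ ρ : ℝ} (h0 : 0 ≤ θ) (hdeg : ∀ i, θ * G.degree i < 1) (hρ : ρ < 1)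
    (hθ : gossipParam (1 - θ • G.lapMatrix ℝ) ≤ ρ) :
    ∃ W, IsGossip G W ∧ gossipParam W = ρ := by
  have hcont : Continuous fun t : ℝ => gossipParam (1 - t • G.lapMatrix ℝ) := by
    unfold gossipParam
    simp only [map_sub, map_smul]
    fun_prop
  have h1 : 1 ≤ gossipParam (1 - (0 : ℝ) • G.lapMatrix ℝ) := by
    rw [zero_smul, sub_zero]
    exact one_le_gossipParam_one hm
  obtain ⟨t, ht, hval⟩ := intermediate_value_Icc' h0 hcont.continuousOn ⟨hθ, hρ.le.trans h1⟩
  -- At `t = 0` the edge weights would vanish; this is excluded because the parameter there is at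
  -- least `1 > ρ`.
  have ht0 : t ≠ 0 := by
    rintro rfl
    simp only at hval
    linarith
  refine ⟨_, isGossip_one_sub_smul_lapMatrix G (lt_of_le_of_ne ht.1 ht0.symm) fun i => ?_, hval⟩
  exact lt_of_le_of_lt (mul_le_mul_of_nonneg_right ht.2 (Nat.cast_nonneg _)) (hdeg i)

theorem gossipParam_pathGraph_two [DecidableRel (SimpleGraph.pathGraph 2).Adj] :
    gossipParam (1 - (1 / 2 : ℝ) • (SimpleGraph.pathGraph 2).lapMatrix ℝ) ≤ 0 := by
  refine gossipParam_le le_rfl fun x => ?_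
  have h : ∀ i, ((1 - (1 / 2 : ℝ) • (SimpleGraph.pathGraph 2).lapMatrix ℝ
      - of fun _ _ => 1 / ((2 : ℕ) : ℝ)) *ᵥ x) i = 0 := by
    intro i
    rw [sub_mulVec, sub_mulVec, one_mulVec, smul_mulVec, Pi.sub_apply, Pi.sub_apply,
      Pi.smul_apply, lapMatrix_mulVec_eq_sum]
    fin_cases i <;> simp [SimpleGraph.pathGraph_adj, mulVec, dotProduct, Fin.sum_univ_two] <;> ring
  rw [sum_eq_zero fun i _ => by rw [h i, zero_pow two_ne_zero]]
  simp

/-- Paths of length proportional to `1 / √(1 - ρ)` carry a gossip matrix of parameter `ρ`. -/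
theorem exists_isGossip_pathGraph {ρ : ℝ} (h0 : 0 ≤ ρ) (h1 : ρ < 1) :
    ∃ (k : ℕ) (W : Matrix (Fin (4 * k + 2)) (Fin (4 * k + 2)) ℝ),
      IsGossip (SimpleGraph.pathGraph (4 * k + 2)) W ∧ gossipParam W = ρ ∧
        1 ≤ (32 * (2 * k + 1 : ℝ)) ^ 2 * (1 - ρ) := by
  classical
  -- When `ρ` is bounded away from `1`, two agents suffice: averaging them has parameter `0`, so
  -- every such `ρ` is attained.
  by_cases hlt : 1 / 128 < 1 - ρ
  · obtain ⟨W, hW, hρ⟩ := exists_isGossip_of_gossipParam_le (SimpleGraph.pathGraph 2) le_rfl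
      (θ := 1 / 2) (by norm_num) (fun i => by
        have h : ((SimpleGraph.pathGraph 2).degree i : ℝ) ≤ 1 := by
          have := (SimpleGraph.pathGraph 2).degree_lt_card_verts i
          rw [Fintype.card_fin] at this
          exact_mod_cast Nat.lt_succ_iff.1 this
        linarith) h1 (gossipParam_pathGraph_two.trans h0)
    exact ⟨0, W, hW, hρ, by norm_num; linarith⟩
  · have hpos : 0 < 1 - ρ := by linarith
    -- With `k + 1 = ⌊√t⌋` one has `(4k+2)² ≤ 16t`, exactly what `2(1-ρ) ≤ 1/(4(4k+2)²)` requires.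
    set t : ℝ := 1 / (128 * (1 - ρ)) with ht
    have ht1 : 1 ≤ t := by
      rw [ht, le_div_iff₀ (by positivity)]
      linarith
    have htρ : t * (128 * (1 - ρ)) = 1 := by rw [ht]; field_simp
    have hs1 : 1 ≤ ⌊√t⌋₊ := (Nat.one_le_floor_iff _).2 (Real.one_le_sqrt.2 ht1)
    obtain ⟨k, hk⟩ : ∃ k, ⌊√t⌋₊ = k + 1 := ⟨⌊√t⌋₊ - 1, by omega⟩
    have hle : ((k : ℝ) + 1) ^ 2 ≤ t := by
      have := Nat.floor_le (Real.sqrt_nonneg t)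
      rw [hk] at this
      push_cast at this
      exact (Real.le_sqrt (by positivity) (by positivity)).1 this
    have hge : t ≤ ((k : ℝ) + 2) ^ 2 := by
      have := (Nat.lt_floor_add_one (√t)).le
      rw [hk] at this
      push_cast at this
      rw [Real.sqrt_le_left (by positivity)] at this
      linarith
    have hk0 : (0 : ℝ) ≤ k := Nat.cast_nonneg k
    obtain ⟨W, hW, hρ⟩ := exists_isGossip_of_gossipParam_le (SimpleGraph.pathGraph (4 * k + 2))
      (by omega) (θ := 1 / 4) (by norm_num) (fun i => by
        have h : ((SimpleGraph.pathGraph (4 * k + 2)).degree i : ℝ) ≤ 2 := by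
          exact_mod_cast degree_pathGraph_le i
        linarith) h1 (gossipParam_pathGraph_le (by omega) h0 (by
          have h2 : 1 - ρ ^ 2 ≤ 2 * (1 - ρ) := by nlinarith
          have h3 : 2 * (1 - ρ) ≤ 1 / (4 * ((4 * k + 2 : ℕ) : ℝ) ^ 2) := by
            rw [le_div_iff₀ (by positivity)]
            push_cast
            have h4 : (4 * (k : ℝ) + 2) ^ 2 ≤ 16 * t := by nlinarith
            calc 2 * (1 - ρ) * (4 * (4 * (k : ℝ) + 2) ^ 2)
                ≤ 2 * (1 - ρ) * (4 * (16 * t)) := by gcongr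
              _ = 1 := by linarith
          linarith))
    refine ⟨k, W, hW, hρ, ?_⟩
    have h5 : 128 * t ≤ (32 * (2 * k + 1 : ℝ)) ^ 2 := by nlinarith
    calc (1 : ℝ) = 128 * t * (1 - ρ) := by linarith
      _ ≤ _ := by gcongr

end Network

/-! ### Quadratic functions on a Hilbert space -/

section Quadratic

variable {E : Type*} [NormedAddCommGroup E] [InnerProductSpace ℝ E]

/-- The quadratic function `x ↦ ½⟨H x, x⟩ - ⟨b, x⟩`. -/
def quad (H : E →L[ℝ] E) (b : E) (x : E) : ℝ :=
  1 / 2 * inner ℝ (H x) x - inner ℝ b x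

variable {H : E →L[ℝ] E} (hH : (H : E →ₗ[ℝ] E).IsSymmetric)

include hH in
theorem quad_eq_add (b x y : E) :
    quad H b y = quad H b x + inner ℝ (H x - b) (y - x) + 1 / 2 * inner ℝ (H (y - x)) (y - x) := by
  have h : inner ℝ (H y) x = inner ℝ (H x) y := by
    rw [real_inner_comm]
    exact (hH x y).symm
  simp only [quad, map_sub, inner_sub_left, inner_sub_right, h]
  ring

include hH in
theorem hasGradientAt_quad [CompleteSpace E] (b x : E) :
    HasGradientAt (quad H b) (H x - b) x := by
  rw [hasGradientAt_iff_hasFDerivAt]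
  have h1 : HasFDerivAt (fun y => inner ℝ (H y) y) _ x :=
    (H.hasFDerivAt (x := x)).inner ℝ (hasFDerivAt_id x)
  have h2 : HasFDerivAt (fun y : E => inner ℝ b y) (innerSL ℝ b) x := (innerSL ℝ b).hasFDerivAt
  refine ((h1.const_mul (1 / 2 : ℝ)).sub h2).congr_fderiv ?_
  ext y
  have h : inner ℝ (H y) x = inner ℝ (H x) y := by
    rw [real_inner_comm]
    exact (hH x y).symm
  simp [fderivInnerCLM_apply, h]
  ring

include hH in
theorem gradient_quad [CompleteSpace E] (b : E) : gradient (quad H b) = fun x => H x - b :=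
  funext fun x => (hasGradientAt_quad hH b x).gradient

include hH in
theorem quad_add_le_of_apply_eq {μ : ℝ} (hμ : ∀ x, μ * ‖x‖ ^ 2 ≤ inner ℝ (H x) x) {b x : E}
    (hx : H x = b) (y : E) : quad H b x + μ / 2 * ‖y - x‖ ^ 2 ≤ quad H b y := by
  rw [quad_eq_add hH b x y, hx, sub_self, inner_zero_left]
  linarith [hμ (y - x)]

include hH in
theorem convexOn_quad (h0 : ∀ x, 0 ≤ inner ℝ (H x) x) (b : E) :
    ConvexOn ℝ Set.univ (quad H b) := by
  refine ⟨convex_univ, fun x _ y _ s t hs ht hst => ?_⟩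
  set z := s • x + t • y
  have hx := quad_eq_add hH b z x
  have hy := quad_eq_add hH b z y
  have hz : s * inner ℝ (H z - b) (x - z) + t * inner ℝ (H z - b) (y - z) = 0 := by
    rw [← inner_smul_right, ← inner_smul_right, ← inner_add_right]
    have : s • (x - z) + t • (y - z) = 0 := by
      rw [smul_sub, smul_sub, sub_add_sub_comm, ← add_smul, hst, one_smul, sub_self]
    rw [this, inner_zero_right]
  have hzz : quad H b z = s * quad H b z + t * quad H b z := by rw [← add_mul, hst, one_mul]
  rw [smul_eq_mul, smul_eq_mul, hx, hy, hzz]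
  nlinarith [mul_nonneg hs (h0 (x - z)), mul_nonneg ht (h0 (y - z))]

include hH in
theorem strongConvexOn_quad {μ : ℝ} (hμ : ∀ x, μ * ‖x‖ ^ 2 ≤ inner ℝ (H x) x) (b : E) :
    StrongConvexOn Set.univ μ (quad H b) := by
  rw [strongConvexOn_iff_convex]
  have hsym : ((H - μ • (1 : E →L[ℝ] E) : E →L[ℝ] E) : E →ₗ[ℝ] E).IsSymmetric := by
    intro x y
    have := hH x y
    simp only [ContinuousLinearMap.coe_coe] at this
    simp [inner_sub_left, inner_sub_right, inner_smul_left, inner_smul_right, this]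
  convert convexOn_quad hsym (fun x => ?_) b using 2 with x
  · simp [quad, inner_sub_left, inner_smul_left]
    ring
  · simp [inner_sub_left, inner_smul_left]
    exact hμ x

theorem avg_quad {m : ℕ} (H : Fin m → Ell2 →L[ℝ] Ell2) (b : Fin m → Ell2) :
    avg (fun i => quad (H i) (b i))
      = quad ((1 / (m : ℝ)) • ∑ i, H i) ((1 / (m : ℝ)) • ∑ i, b i) := by
  funext x
  simp only [avg, quad, Finset.sum_sub_distrib, ← Finset.mul_sum, smul_apply,
    sum_apply, inner_smul_left, sum_inner, RCLike.conj_to_real]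
  ring

theorem hessian_quad {H : Ell2 →L[ℝ] Ell2} (hH : (H : Ell2 →ₗ[ℝ] Ell2).IsSymmetric) (b x : Ell2) :
    hessian (quad H b) x = H := by
  rw [hessian, gradient_quad hH]
  exact (H.hasFDerivAt.sub_const b).fderiv

end Quadratic

/-! ### Operators on `ℓ²` built from coordinate involutions -/

section Sequence

theorem ell2_inner_eq_tsum (x y : Ell2) : inner ℝ x y = ∑' n, x n * y n := by
  rw [lp.inner_eq_tsum]
  exact tsum_congr fun n => mul_comm _ _

theorem ell2_norm_sq_eq_tsum (x : Ell2) : ‖x‖ ^ 2 = ∑' n, x n ^ 2 := by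
  rw [← real_inner_self_eq_norm_sq, ell2_inner_eq_tsum]
  exact tsum_congr fun n => (sq _).symm

theorem memℓp_two_iff {x : ℕ → ℝ} : Memℓp x 2 ↔ Summable fun n => x n ^ 2 := by
  rw [memℓp_gen_iff (by simp)]
  simp

theorem ell2_summable_sq (x : Ell2) : Summable fun n => x n ^ 2 :=
  memℓp_two_iff.1 (lp.memℓp x)

/-- The isometry of `ℓ²` that permutes the coordinates. -/
def permIsometry (π : Equiv.Perm ℕ) : Ell2 →ₗᵢ[ℝ] Ell2 where
  toFun x := ⟨fun n => x (π n), memℓp_two_iff.2 ((ell2_summable_sq x).comp_injective π.injective)⟩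
  map_add' _ _ := rfl
  map_smul' _ _ := rfl
  norm_map' x := by
    refine (sq_eq_sq₀ (norm_nonneg _) (norm_nonneg _)).1 ?_
    rw [ell2_norm_sq_eq_tsum, ell2_norm_sq_eq_tsum]
    exact π.tsum_eq fun n => x n ^ 2

/-- The operator `1 - P`, where `P` permutes the coordinates. -/
def permDiff (π : Equiv.Perm ℕ) : Ell2 →L[ℝ] Ell2 :=
  1 - (permIsometry π).toContinuousLinearMap

theorem permDiff_isSymmetric {π : Equiv.Perm ℕ} (hπ : Function.Involutive π) :
    (permDiff π : Ell2 →ₗ[ℝ] Ell2).IsSymmetric := by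
  intro x y
  have h : inner ℝ (permIsometry π x) y = inner ℝ x (permIsometry π y) := by
    rw [ell2_inner_eq_tsum, ell2_inner_eq_tsum, ← π.tsum_eq]
    refine tsum_congr fun n => ?_
    change x (π (π n)) * y (π n) = x n * y (π n)
    rw [hπ n]
  change inner ℝ (x - permIsometry π x) y = inner ℝ x (y - permIsometry π y)
  rw [inner_sub_left, inner_sub_right, h]

theorem inner_permDiff_nonneg (π : Equiv.Perm ℕ) (x : Ell2) : 0 ≤ inner ℝ (permDiff π x) x := by
  change 0 ≤ inner ℝ (x - permIsometry π x) x
  have h := real_inner_le_norm (permIsometry π x) x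
  rw [LinearIsometry.norm_map] at h
  rw [inner_sub_left, real_inner_self_eq_norm_mul_norm]
  linarith

theorem norm_permDiff_le (π : Equiv.Perm ℕ) : ‖permDiff π‖ ≤ 2 := by
  refine ContinuousLinearMap.opNorm_le_bound _ zero_le_two fun x => ?_
  refine (norm_sub_le x (permIsometry π x)).trans ?_
  rw [LinearIsometry.norm_map, two_mul]

/-- The operator `μ + a (1 - P) + c (1 - Q)` for two coordinate permutations `P` and `Q`. -/
def chainOp (σ τ : Equiv.Perm ℕ) (μ a c : ℝ) : Ell2 →L[ℝ] Ell2 :=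
  μ • 1 + a • permDiff σ + c • permDiff τ

variable {σ τ : Equiv.Perm ℕ}

theorem chainOp_apply (μ a c : ℝ) (x : Ell2) (n : ℕ) :
    chainOp σ τ μ a c x n = (μ + a + c) * x n - a * x (σ n) - c * x (τ n) := by
  change μ * x n + a * (x n - x (σ n)) + c * (x n - x (τ n)) = _
  ring

theorem chainOp_isSymmetric (hσ : Function.Involutive σ) (hτ : Function.Involutive τ)
    (μ a c : ℝ) : (chainOp σ τ μ a c : Ell2 →ₗ[ℝ] Ell2).IsSymmetric := by
  intro x y
  have h1 := permDiff_isSymmetric hσ x y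
  have h2 := permDiff_isSymmetric hτ x y
  simp only [ContinuousLinearMap.coe_coe] at h1 h2
  simp [chainOp, inner_add_left, inner_add_right, inner_smul_left, inner_smul_right, h1, h2]

theorem mul_norm_sq_le_inner_chainOp {μ a c : ℝ} (ha : 0 ≤ a) (hc : 0 ≤ c) (x : Ell2) :
    μ * ‖x‖ ^ 2 ≤ inner ℝ (chainOp σ τ μ a c x) x := by
  have h1 := mul_nonneg ha (inner_permDiff_nonneg σ x)
  have h2 := mul_nonneg hc (inner_permDiff_nonneg τ x)
  simp only [chainOp, add_apply, smul_apply,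
    one_apply_eq_self, inner_add_left, inner_smul_left, RCLike.conj_to_real,
    real_inner_self_eq_norm_sq]
  linarith

theorem norm_chainOp_le (μ a c : ℝ) : ‖chainOp σ τ μ a c‖ ≤ |μ| + 2 * |a| + 2 * |c| := by
  have h1 : ‖μ • (1 : Ell2 →L[ℝ] Ell2)‖ ≤ |μ| := by
    rw [norm_smul, Real.norm_eq_abs]
    exact mul_le_of_le_one_right (abs_nonneg μ) ContinuousLinearMap.norm_id_le
  have h2 : ‖a • permDiff σ‖ ≤ 2 * |a| := by
    rw [norm_smul, Real.norm_eq_abs, mul_comm]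
    exact mul_le_mul_of_nonneg_right (norm_permDiff_le σ) (abs_nonneg a)
  have h3 : ‖c • permDiff τ‖ ≤ 2 * |c| := by
    rw [norm_smul, Real.norm_eq_abs, mul_comm]
    exact mul_le_mul_of_nonneg_right (norm_permDiff_le τ) (abs_nonneg c)
  exact (norm_add₃_le).trans (add_le_add (add_le_add h1 h2) h3)

theorem chainOp_sub_chainOp (μ a c a' c' : ℝ) :
    chainOp σ τ μ a c - chainOp σ τ μ a' c' = chainOp σ τ 0 (a - a') (c - c') := by
  simp only [chainOp]
  module

theorem smul_sum_chainOp {m : ℕ} (hm : m ≠ 0) (μ : ℝ) (a c : Fin m → ℝ) :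
    (1 / (m : ℝ)) • ∑ i, chainOp σ τ μ (a i) (c i)
      = chainOp σ τ μ (1 / m * ∑ i, a i) (1 / m * ∑ i, c i) := by
  have hm' : (m : ℝ) ≠ 0 := Nat.cast_ne_zero.2 hm
  simp only [chainOp, Finset.sum_add_distrib, ← Finset.sum_smul, smul_add, smul_smul,
    Finset.sum_const, Finset.card_univ, Fintype.card_fin, nsmul_eq_mul]
  rw [one_div, inv_mul_cancel_left₀ hm']

end Sequence

/-! ### Supports preserved by the oracle -/

section Oracle

/-- The sequences supported in `S`. -/
def supportedIn (S : Set ℕ) : Submodule ℝ Ell2 where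
  carrier := {x | ∀ n, n ∉ S → x n = 0}
  add_mem' {x y} hx hy n hn := by
    change x n + y n = 0
    rw [hx n hn, hy n hn, add_zero]
  zero_mem' _ _ := rfl
  smul_mem' c x hx n hn := by
    change c * x n = 0
    rw [hx n hn, mul_zero]

theorem mem_supportedIn {S : Set ℕ} {x : Ell2} : x ∈ supportedIn S ↔ ∀ n, n ∉ S → x n = 0 :=
  Iff.rfl

theorem supportedIn_mono {S T : Set ℕ} (h : S ⊆ T) : supportedIn S ≤ supportedIn T :=
  fun _ hx n hn => hx n fun hS => hn (h hS)

/-- The part of a sequence that lies outside `S`. -/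
theorem exists_eq_compl (S : Set ℕ) (x : Ell2) :
    ∃ z : Ell2, (∀ n ∈ S, z n = 0) ∧ ∀ n, n ∉ S → z n = x n := by
  classical
  refine ⟨⟨fun n => if n ∈ S then 0 else x n, memℓp_two_iff.2 ?_⟩, fun n hn => if_pos hn,
    fun n hn => if_neg hn⟩
  refine (ell2_summable_sq x).of_nonneg_of_le (fun n => sq_nonneg _) fun n => ?_
  split_ifs
  · rw [zero_pow two_ne_zero]
    exact sq_nonneg _
  · exact le_rfl

variable {σ τ : Equiv.Perm ℕ} {S : Set ℕ} {a c : ℝ} {d : ℕ → ℝ} {T : Ell2 →L[ℝ] Ell2}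

theorem apply_mem_supportedIn (hT : ∀ x n, T x n = d n * x n - a * x (σ n) - c * x (τ n))
    (ha : a = 0 ∨ ∀ n, σ n ∈ S ↔ n ∈ S) (hc : c = 0 ∨ ∀ n, τ n ∈ S ↔ n ∈ S)
    {x : Ell2} (hx : x ∈ supportedIn S) : T x ∈ supportedIn S := by
  intro n hn
  have h1 : a * x (σ n) = 0 := by
    rcases ha with h | h
    · rw [h, zero_mul]
    · rw [hx _ (mt (h n).1 hn), mul_zero]
  have h2 : c * x (τ n) = 0 := by
    rcases hc with h | h
    · rw [h, zero_mul]
    · rw [hx _ (mt (h n).1 hn), mul_zero]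
  rw [hT, hx n hn, h1, h2]
  ring

/-- `T` respects the splitting into coordinates inside and outside `S`, so it sends the outside part
of `x` to the outside part of `T x`, which is zero. Injectivity alone is used, so the shift `D` may
have any sign. -/
theorem mem_supportedIn_of_apply (hT : ∀ x n, T x n = d n * x n - a * x (σ n) - c * x (τ n))
    (ha : a = 0 ∨ ∀ n, σ n ∈ S ↔ n ∈ S) (hc : c = 0 ∨ ∀ n, τ n ∈ S ↔ n ∈ S)
    (hinj : ∀ z, T z = 0 → z = 0) {x : Ell2} (hx : T x ∈ supportedIn S) : x ∈ supportedIn S := by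
  obtain ⟨z, hzS, hzx⟩ := exists_eq_compl S x
  have hz : z = 0 := by
    refine hinj z (lp.ext (funext fun n => ?_))
    rw [hT]
    change _ = (0 : ℝ)
    by_cases hn : n ∈ S
    · have h1 : a * z (σ n) = 0 := by
        rcases ha with h | h
        · rw [h, zero_mul]
        · rw [hzS _ ((h n).2 hn), mul_zero]
      have h2 : c * z (τ n) = 0 := by
        rcases hc with h | h
        · rw [h, zero_mul]
        · rw [hzS _ ((h n).2 hn), mul_zero]
      rw [hzS n hn, h1, h2]
      ring
    · have h1 : a * z (σ n) = a * x (σ n) := by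
        rcases ha with h | h
        · rw [h, zero_mul, zero_mul]
        · rw [hzx _ (mt (h n).1 hn)]
      have h2 : c * z (τ n) = c * x (τ n) := by
        rcases hc with h | h
        · rw [h, zero_mul, zero_mul]
        · rw [hzx _ (mt (h n).1 hn)]
      rw [hzx n hn, h1, h2, ← hT]
      exact hx n hn
  intro n hn
  rw [← hzx n hn, hz]
  rfl

variable {μ : ℝ} {b : Ell2}

/-- Hessians, shifted Hessians and the implicit operator `τ₁ + τ₂ H` all have the form diagonal
minus `a σ` minus `c τ`. A permutation must preserve `S` only if its coefficient is nonzero, so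
agents without couplings satisfy this for every `S`. -/
theorem computable_mem_supportedIn (hσ : Function.Involutive σ) (hτ : Function.Involutive τ)
    (hμ : 0 < μ) (ha0 : 0 ≤ a) (hc0 : 0 ≤ c)
    (ha : a = 0 ∨ ∀ n, σ n ∈ S ↔ n ∈ S) (hc : c = 0 ∨ ∀ n, τ n ∈ S ↔ n ∈ S)
    (hb : b ∈ supportedIn S) {M : Set Ell2} (hM : M ⊆ supportedIn S) {x : Ell2}
    (hx : Computable (quad (chainOp σ τ μ a c) b) M x) : x ∈ supportedIn S := by
  have hsym := chainOp_isSymmetric hσ hτ μ a c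
  set H := chainOp σ τ μ a c with hH
  have hshift : ∀ D : Ell2 →L[ℝ] Ell2, IsDiagonal D → ∃ d : ℕ → ℝ, ∀ x n,
      (H + D) x n = d n * x n - a * x (σ n) - c * x (τ n) := by
    rintro D ⟨d, hd⟩
    refine ⟨fun n => μ + a + c + d n, fun x n => ?_⟩
    change H x n + D x n = _
    rw [hH, chainOp_apply, hd]
    ring
  have horacle : Submodule.span ℝ {v | OracleVector (quad H b) M v} ≤ supportedIn S := by
    refine Submodule.span_le.2 ?_
    rintro v (⟨hv⟩ | ⟨x', hx'⟩ | ⟨x', x'', hx', hx'', D, hD⟩ | ⟨x', x'', hx', hx'', D, hD, hinv⟩)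
    · exact hM ‹_›
    · rw [gradient_quad hsym]
      exact (supportedIn S).sub_mem (apply_mem_supportedIn (chainOp_apply μ a c) ha hc (hM hx')) hb
    · rw [hessian_quad hsym]
      obtain ⟨d, hd⟩ := hshift D hD
      exact apply_mem_supportedIn hd ha hc (hM hx'')
    · rw [hessian_quad hsym] at hinv ⊢
      obtain ⟨d, hd⟩ := hshift D hD
      refine mem_supportedIn_of_apply hd ha hc (fun z hz => ?_) ?_
      · have : Ring.inverse (H + D) ((H + D) z) = Ring.inverse (H + D) 0 := by rw [hz]
        rwa [map_zero, ← mul_apply_eq_comp, Ring.inverse_mul_cancel _ hinv] at this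
      · rw [← mul_apply_eq_comp, Ring.mul_inverse_cancel _ hinv]
        exact hM hx''
  obtain ⟨τ₁, τ₂, h1, h2, hpos, hspan⟩ := hx
  have hmem := horacle hspan
  rw [gradient_quad hsym] at hmem
  -- The implicit step is a linear equation once `τ₂ b` is moved across; its operator is injective,
  -- being bounded below by `τ₁ + τ₂ μ > 0`.
  have hmem' : (τ₁ • (1 : Ell2 →L[ℝ] Ell2) + τ₂ • H) x ∈ supportedIn S := by
    have := (supportedIn S).add_mem hmem ((supportedIn S).smul_mem τ₂ hb)
    convert this using 1
    simp only [add_apply, smul_apply,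
      one_apply_eq_self, smul_sub]
    abel
  refine mem_supportedIn_of_apply (σ := σ) (τ := τ) (S := S) (a := τ₂ * a) (c := τ₂ * c)
    (d := fun _ => τ₁ + τ₂ * (μ + a + c)) (fun y n => ?_) ?_ ?_ (fun z hz => ?_) hmem'
  · change τ₁ * y n + τ₂ * H y n = _
    rw [hH, chainOp_apply]
    ring
  · exact ha.imp_left fun h => by rw [h, mul_zero]
  · exact hc.imp_left fun h => by rw [h, mul_zero]
  · have h3 : τ₁ * ‖z‖ ^ 2 + τ₂ * inner ℝ (H z) z = 0 := by
      have := congrArg (fun w => inner ℝ w z) hz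
      simpa [inner_add_left, inner_smul_left] using this
    have h4 : μ * ‖z‖ ^ 2 ≤ inner ℝ (H z) z := mul_norm_sq_le_inner_chainOp ha0 hc0 z
    have h5 : 0 < τ₁ + τ₂ * μ := by
      rcases h2.eq_or_lt with h | h
      · rw [← h, zero_mul]
        linarith
      · have := mul_pos h hμ
        linarith
    have h6 : (τ₁ + τ₂ * μ) * ‖z‖ ^ 2 ≤ 0 := by
      linarith [mul_le_mul_of_nonneg_left h4 h2]
    have h7 : ‖z‖ ^ 2 = 0 :=
      le_antisymm (le_of_mul_le_mul_left (by rwa [mul_zero]) h5) (sq_nonneg _)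
    exact norm_eq_zero.1 (pow_eq_zero_iff two_ne_zero |>.1 h7)

theorem localPhase_subset {fi : Ell2 → ℝ} {V : Set Ell2}
    (h : ∀ M ⊆ V, ∀ x, Computable fi M x → x ∈ V) {M M' : Set Ell2} (hM : M ⊆ V)
    (hphase : LocalPhase fi M M') : M' ⊆ V := by
  induction hphase with
  | refl => exact hM
  | tail _ hstep ih =>
    obtain ⟨x, hx, rfl⟩ := hstep
    exact Set.insert_subset (h _ ih x hx) ih

theorem communicate_subset {m : ℕ} {G : SimpleGraph (Fin m)} {M : Fin m → Set Ell2} {i : Fin m}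
    {V : Submodule ℝ Ell2} (h : ∀ j, j = i ∨ G.Adj i j → M j ⊆ V) : communicate G M i ⊆ V := by
  refine Submodule.span_le.2 (Set.iUnion₂_subset fun j hj => ?_)
  exact h j hj

/-- A time-dependent bound on the memories that local steps and communication respect. -/
theorem produces_mem {m : ℕ} {G : SimpleGraph (Fin m)} {f : Fin m → Ell2 → ℝ}
    (V : ℕ → Fin m → Submodule ℝ Ell2)
    (hlocal : ∀ t i, ∀ M ⊆ (V t i : Set Ell2), ∀ x, Computable (f i) M x → x ∈ V t i)
    (hcomm : ∀ t i j, j = i ∨ G.Adj i j → V t j ≤ V (t + 1) i) {N : ℕ} {x : Fin m → Ell2}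
    (h : Produces G f N x) (i : Fin m) : x i ∈ V N i := by
  obtain ⟨A, B, hA0, hAB, hBA, hx⟩ := h
  have key : ∀ t ≤ N, ∀ i, A t i ⊆ V t i := by
    intro t
    induction t with
    | zero =>
      intro _ i
      rw [hA0, Set.singleton_subset_iff]
      exact (V 0 i).zero_mem
    | succ t ih =>
      intro ht i
      rw [hBA t ht i]
      refine communicate_subset fun j hj => ?_
      exact (localPhase_subset (hlocal t j) (ih (by omega) j) (hAB t (by omega) j)).trans
        (hcomm t i j hj)
  exact localPhase_subset (hlocal N i) (key N le_rfl i) (hAB N le_rfl i) (hx i)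

end Oracle

/-! ### The hard instance and the propagation of supports -/

section Chain

/-- The permutation of `ℕ` that exchanges `2j` and `2j + 1`. -/
def evenSwap : Equiv.Perm ℕ :=
  Function.Involutive.toPerm (fun n => if n % 2 = 0 then n + 1 else n - 1) fun n => by
    dsimp only
    split_ifs <;> omega

/-- The permutation of `ℕ` that exchanges `2j + 1` and `2j + 2`, and fixes `0`. -/
def oddSwap : Equiv.Perm ℕ :=
  Function.Involutive.toPerm
    (fun n => if n = 0 then 0 else if n % 2 = 1 then n + 1 else n - 1) fun n => by
    rcases n with _ | n
    · rfl
    · rcases Nat.mod_two_eq_zero_or_one n with h | h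
      · have h1 : (n + 1) % 2 = 1 := by omega
        have h2 : (n + 2) % 2 = 0 := by omega
        simp [h1, h2]
      · have h1 : (n + 1) % 2 = 0 := by omega
        have h2 : n ≠ 0 := by omega
        simp [h1, h, h2]

theorem evenSwap_apply (n : ℕ) : evenSwap n = if n % 2 = 0 then n + 1 else n - 1 := rfl

theorem oddSwap_apply (n : ℕ) :
    oddSwap n = if n = 0 then 0 else if n % 2 = 1 then n + 1 else n - 1 := rfl

theorem evenSwap_involutive : Function.Involutive evenSwap := evenSwap.left_inv

theorem oddSwap_involutive : Function.Involutive oddSwap := oddSwap.left_inv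

/-- The coordinates that can be reached after `t` rounds at position `u` of a line of length `d`,
when even coordinates are discovered at position `0` and odd ones at position `d`. -/
def frontier (d u t : ℕ) : Set ℕ :=
  {n | n * d + (if n % 2 = 0 then u else d - u) ≤ t}

/-- At position `0` the coordinates `2j+1` and `2j+2` have the same arrival time `(2j+2)d`.
Likewise, at position `d`, `2j` and `2j+1` both arrive at time `(2j+1)d`. -/
theorem oddSwap_mem_frontier (d t n : ℕ) : oddSwap n ∈ frontier d 0 t ↔ n ∈ frontier d 0 t := by
  rw [oddSwap_apply]
  rcases n with _ | n
  · simp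
  · rcases Nat.mod_two_eq_zero_or_one n with h | h
    · have h1 : (n + 1) % 2 = 1 := by omega
      have h2 : (n + 1 + 1) % 2 = 0 := by omega
      simp [frontier, h1, h2, add_mul]
    · have h1 : (n + 1) % 2 = 0 := by omega
      simp [frontier, h1, h, add_mul]

theorem evenSwap_mem_frontier (d t n : ℕ) : evenSwap n ∈ frontier d d t ↔ n ∈ frontier d d t := by
  rw [evenSwap_apply]
  rcases Nat.mod_two_eq_zero_or_one n with h | h
  · have h1 : (n + 1) % 2 = 1 := by omega
    simp [frontier, h1, h, add_mul]
  · obtain ⟨m, rfl⟩ : ∃ m, n = m + 1 := ⟨n - 1, by omega⟩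
    have h1 : m % 2 = 0 := by omega
    simp [frontier, h1, h, add_mul]

/-- Arrival times change by at most one between neighbouring positions, and a round adds one unit of
time. -/
theorem frontier_subset {d u v t : ℕ} (h1 : u ≤ v + 1) (h2 : v ≤ u + 1) :
    frontier d u t ⊆ frontier d v (t + 1) := by
  intro n hn
  simp only [frontier, Set.mem_ofPred_eq] at hn ⊢
  split_ifs at hn ⊢ <;> omega

theorem exists_bound_frontier {d t : ℕ} (hd : 0 < d) :
    ∃ K : ℕ, K * d ≤ 2 * t ∧ ∀ n ∈ frontier d d t, n < K := by
  rcases lt_or_ge t d with h | h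
  -- Before time `d` nothing has reached position `d`, so `K = 0`. This is what allows a bound `K d
  -- ≤ 2t` without additive constant: afterwards `(t/d + 1) d ≤ t + d ≤ 2t`.
  · refine ⟨0, by simp, fun n hn => ?_⟩
    simp only [frontier, Set.mem_ofPred_eq] at hn
    rcases Nat.eq_zero_or_pos n with rfl | h0
    · simp at hn
      omega
    · have := Nat.mul_le_mul_right d h0
      omega
  · refine ⟨t / d + 1, ?_, fun n hn => ?_⟩
    · have := Nat.div_mul_le_self t d
      rw [add_mul]
      omega
    · simp only [frontier, Set.mem_ofPred_eq] at hn
      exact Nat.lt_succ_of_le ((Nat.le_div_iff_mul_le hd).2 (by omega))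

/-- The position of an agent on the segment between the two groups of extremal agents. -/
def position (k i : ℕ) : ℕ := min (i - k) (2 * k + 1)

/-- The weight of the odd blocks in the loss of agent `i`. -/
def leftWeight (k : ℕ) (γ : ℝ) (i : Fin (4 * k + 2)) : ℝ :=
  if i.val ≤ k then γ * (4 * k + 2) / (k + 1) else 0

/-- The weight of the even blocks in the loss of agent `i`. -/
def rightWeight (k : ℕ) (γ : ℝ) (i : Fin (4 * k + 2)) : ℝ :=
  if 3 * k + 1 ≤ i.val then γ * (4 * k + 2) / (k + 1) else 0

theorem average_leftWeight (k : ℕ) (γ : ℝ) :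
    1 / ((4 * k + 2 : ℕ) : ℝ) * ∑ i, leftWeight k γ i = γ := by
  have h : (Finset.range (4 * k + 2)).filter (fun i => i ≤ k) = Finset.range (k + 1) := by
    ext i
    simp only [Finset.mem_filter, Finset.mem_range]
    omega
  unfold leftWeight
  rw [Fin.sum_univ_eq_sum_range (fun i => if i ≤ k then γ * (4 * k + 2) / (k + 1) else 0),
    ← Finset.sum_filter, h, Finset.sum_const, Finset.card_range, nsmul_eq_mul]
  push_cast
  field_simp

theorem average_rightWeight (k : ℕ) (γ : ℝ) :
    1 / ((4 * k + 2 : ℕ) : ℝ) * ∑ i, rightWeight k γ i = γ := by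
  have h : (Finset.range (4 * k + 2)).filter (fun i => 3 * k + 1 ≤ i)
      = Finset.Ico (3 * k + 1) (4 * k + 2) := by
    ext i
    simp only [Finset.mem_filter, Finset.mem_range, Finset.mem_Ico]
    omega
  have hcard : 4 * k + 2 - (3 * k + 1) = k + 1 := by omega
  unfold rightWeight
  rw [Fin.sum_univ_eq_sum_range (fun i => if 3 * k + 1 ≤ i then γ * (4 * k + 2) / (k + 1) else 0),
    ← Finset.sum_filter, h, Finset.sum_const, Nat.card_Ico, nsmul_eq_mul, hcard]
  push_cast
  field_simp

/-- Each end group holds at least a quarter of the agents, so concentrating the couplings there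
costs at most a factor `4`, uniformly in `k`. -/
theorem weight_le {k : ℕ} {γ : ℝ} (hγ : 0 ≤ γ) :
    0 ≤ γ * (4 * k + 2) / (k + 1) ∧ γ * (4 * k + 2) / (k + 1) ≤ 4 * γ := by
  refine ⟨by positivity, ?_⟩
  rw [div_le_iff₀ (by positivity)]
  nlinarith

theorem leftWeight_mem {k : ℕ} {γ : ℝ} (hγ : 0 ≤ γ) (i : Fin (4 * k + 2)) :
    0 ≤ leftWeight k γ i ∧ leftWeight k γ i ≤ 4 * γ := by
  unfold leftWeight
  split_ifs
  · exact weight_le hγ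
  · exact ⟨le_rfl, by positivity⟩

theorem rightWeight_mem {k : ℕ} {γ : ℝ} (hγ : 0 ≤ γ) (i : Fin (4 * k + 2)) :
    0 ≤ rightWeight k γ i ∧ rightWeight k γ i ≤ 4 * γ := by
  unfold rightWeight
  split_ifs
  · exact weight_le hγ
  · exact ⟨le_rfl, by positivity⟩

/-- The losses of the hard instance: the tridiagonal quadratic form, its odd blocks and the linear
term being held by the first agents and its even blocks by the last ones. -/
def chainLoss (k : ℕ) (μ γ r : ℝ) (i : Fin (4 * k + 2)) : Ell2 → ℝ :=
  quad (chainOp oddSwap evenSwap μ (leftWeight k γ i) (rightWeight k γ i))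
    ((leftWeight k γ i * r) • lp.single 2 0 1)

theorem avg_chainLoss (k : ℕ) (μ γ r : ℝ) :
    avg (chainLoss k μ γ r) = quad (chainOp oddSwap evenSwap μ γ γ) ((γ * r) • lp.single 2 0 1) := by
  have hb : (1 / ((4 * k + 2 : ℕ) : ℝ)) • ∑ i, (leftWeight k γ i * r) • lp.single 2 0 1
      = ((γ * r) • lp.single 2 0 1 : Ell2) := by
    rw [← Finset.sum_smul, ← Finset.sum_mul, smul_smul, ← mul_assoc, average_leftWeight]
  change avg (fun i => quad _ _) = _
  rw [avg_quad, smul_sum_chainOp (by omega), average_leftWeight, average_rightWeight, hb]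

theorem chainOp_swap_isSymmetric (μ a c : ℝ) :
    (chainOp oddSwap evenSwap μ a c : Ell2 →ₗ[ℝ] Ell2).IsSymmetric :=
  chainOp_isSymmetric oddSwap_involutive evenSwap_involutive μ a c

theorem problemClass_chainLoss (k : ℕ) {μ γ : ℝ} (r : ℝ) (hμ : 0 < μ) (hγ : 0 ≤ γ)
    (h1 : μ + 4 * γ ≤ 1) : ProblemClass μ 1 (chainLoss k μ γ r) := by
  refine ⟨fun i => ?_, fun i x => ?_, fun i => ?_, ?_, ?_⟩
  · refine convexOn_quad (chainOp_swap_isSymmetric _ _ _) (fun x => ?_) _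
    exact (by positivity : 0 ≤ μ * ‖x‖ ^ 2).trans
      (mul_norm_sq_le_inner_chainOp (leftWeight_mem hγ i).1 (rightWeight_mem hγ i).1 x)
  · exact (hasGradientAt_quad (chainOp_swap_isSymmetric _ _ _) _ x).differentiableAt
  · unfold chainLoss
    rw [gradient_quad (chainOp_swap_isSymmetric _ _ _)]
    fun_prop
  · rw [avg_chainLoss]
    exact strongConvexOn_quad (chainOp_swap_isSymmetric _ _ _)
      (mul_norm_sq_le_inner_chainOp hγ hγ) _
  · rw [avg_chainLoss, gradient_quad (chainOp_swap_isSymmetric _ _ _)]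
    refine LipschitzWith.of_dist_le_mul fun x y => ?_
    rw [dist_sub_right, dist_eq_norm, dist_eq_norm, ← map_sub]
    refine ContinuousLinearMap.le_of_opNorm_le _ ((norm_chainOp_le _ _ _).trans ?_) _
    rw [abs_of_pos hμ, abs_of_nonneg hγ, NNReal.coe_one]
    linarith

theorem similar_chainLoss (k : ℕ) {μ γ β : ℝ} (r : ℝ) (hγ : 0 ≤ γ) (hβ : 12 * γ ≤ β) :
    Similar β (chainLoss k μ γ r) := by
  intro i x
  rw [avg_chainLoss, hessian_quad (chainOp_swap_isSymmetric _ _ _), chainLoss,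
    hessian_quad (chainOp_swap_isSymmetric _ _ _), chainOp_sub_chainOp]
  refine (norm_chainOp_le _ _ _).trans ?_
  have h1 : |leftWeight k γ i - γ| ≤ 3 * γ := by
    have := leftWeight_mem hγ i
    rw [abs_le]
    constructor <;> linarith
  have h2 : |rightWeight k γ i - γ| ≤ 3 * γ := by
    have := rightWeight_mem hγ i
    rw [abs_le]
    constructor <;> linarith
  rw [abs_zero]
  linarith

/-- The agents holding odd blocks all sit at position `0` and those holding even blocks at position
`2k+1`, where the frontier is invariant under the corresponding swap; the remaining agents have no
couplings and no linear term. -/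
theorem produces_chainLoss_mem {k : ℕ} {μ γ r : ℝ} (hμ : 0 < μ) (hγ : 0 ≤ γ) {N : ℕ}
    {x : Fin (4 * k + 2) → Ell2}
    (h : Produces (SimpleGraph.pathGraph (4 * k + 2)) (chainLoss k μ γ r) N x)
    (i : Fin (4 * k + 2)) : x i ∈ supportedIn (frontier (2 * k + 1) (position k i) N) := by
  refine produces_mem (fun t i => supportedIn (frontier (2 * k + 1) (position k i) t))
    (fun t i M hM x hx => ?_) (fun t i j hij => supportedIn_mono (frontier_subset ?_ ?_)) h i
  · refine computable_mem_supportedIn oddSwap_involutive evenSwap_involutive hμ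
      (leftWeight_mem hγ i).1 (rightWeight_mem hγ i).1 ?_ ?_ ?_ hM hx
    · by_cases hi : i.val ≤ k
      · have : position k i = 0 := by unfold position; omega
        rw [this]
        exact Or.inr (oddSwap_mem_frontier _ _)
      · exact Or.inl (if_neg hi)
    · by_cases hi : 3 * k + 1 ≤ i.val
      · have : position k i = 2 * k + 1 := by unfold position; omega
        rw [this]
        exact Or.inr (evenSwap_mem_frontier _ _)
      · exact Or.inl (if_neg hi)
    · by_cases hi : i.val ≤ k
      · have : position k i = 0 := by unfold position; omega
        rw [this]
        refine (supportedIn _).smul_mem _ fun n hn => ?_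
        refine lp.single_apply_ne _ _ _ fun h0 => hn ?_
        simp [frontier, h0]
      · rw [leftWeight, if_neg hi, zero_mul, zero_smul]
        exact (supportedIn _).zero_mem
  all_goals
    unfold position
    rcases hij with rfl | hij
    · omega
    · rw [SimpleGraph.pathGraph_adj] at hij
      omega

end Chain

/-! ### The minimizer and its decay -/

section Geometric

/-- The sequence `n ↦ qⁿ`. -/
def geomSeq (q : ℝ) (h0 : 0 ≤ q) (h1 : q < 1) : Ell2 :=
  ⟨fun n => q ^ n, memℓp_two_iff.2 (by
    simp only [← pow_mul, mul_comm _ 2]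
    simp only [pow_mul]
    exact summable_geometric_of_lt_one (sq_nonneg q) (pow_lt_one₀ h0 h1 two_ne_zero))⟩

variable {q : ℝ} {h0 : 0 ≤ q} {h1 : q < 1}

theorem geomSeq_apply (n : ℕ) : geomSeq q h0 h1 n = q ^ n := rfl

theorem geomSeq_ne_zero : geomSeq q h0 h1 ≠ 0 := fun h => by
  have : geomSeq q h0 h1 0 = (0 : Ell2) 0 := by rw [h]
  rw [geomSeq_apply, pow_zero] at this
  exact one_ne_zero this

/-- The quadratic equation for `q` is the recurrence in the rows `n ≥ 1`. Row `0` lacks a left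
neighbour, and its residual fixes the size of the linear term. -/
theorem chainOp_geomSeq {μ γ : ℝ} (hγ : γ ≠ 0) (hq : (μ + 2 * γ) * q = γ * (1 + q ^ 2)) :
    chainOp oddSwap evenSwap μ γ γ (geomSeq q h0 h1)
      = (γ * (μ / γ + 1 - q)) • lp.single 2 0 1 := by
  refine lp.ext (funext fun n => ?_)
  rw [chainOp_apply, lp.coeFn_smul, Pi.smul_apply, smul_eq_mul]
  simp only [geomSeq_apply]
  rcases n with _ | n
  · rw [lp.single_apply_self]
    simp only [oddSwap_apply, evenSwap_apply]
    simp
    field_simp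
  · rw [lp.single_apply_ne _ _ _ (Nat.succ_ne_zero n), mul_zero]
    have key : (μ + γ + γ) * q ^ (n + 1) - γ * q ^ (n + 2) - γ * q ^ n = 0 := by
      linear_combination q ^ n * hq
    rcases Nat.mod_two_eq_zero_or_one n with h | h
    · have h2 : (n + 1) % 2 = 1 := by omega
      simp only [oddSwap_apply, evenSwap_apply, h2, if_true, one_ne_zero, if_false,
        Nat.succ_ne_zero, Nat.add_sub_cancel]
      linarith
    · have h2 : (n + 1) % 2 = 0 := by omega
      simp only [oddSwap_apply, evenSwap_apply, h2, if_true, zero_ne_one, if_false,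
        Nat.succ_ne_zero, Nat.add_sub_cancel]
      linarith

theorem pow_mul_norm_sq_le_norm_sub_geomSeq {x : Ell2} {K : ℕ} (hx : ∀ n, K ≤ n → x n = 0) :
    q ^ (2 * K) * ‖geomSeq q h0 h1‖ ^ 2 ≤ ‖x - geomSeq q h0 h1‖ ^ 2 := by
  rw [ell2_norm_sq_eq_tsum, ell2_norm_sq_eq_tsum, ← tsum_mul_left,
    ← (ell2_summable_sq (x - geomSeq q h0 h1)).sum_add_tsum_nat_add K]
  refine le_add_of_nonneg_of_le (Finset.sum_nonneg fun _ _ => sq_nonneg _) (le_of_eq ?_)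
  refine tsum_congr fun n => ?_
  change q ^ (2 * K) * (q ^ n) ^ 2 = (x (n + K) - q ^ (n + K)) ^ 2
  rw [hx _ (Nat.le_add_left K n)]
  ring

/-- The decay rate of the solution of a tridiagonal system. -/
theorem exists_decay_rate {y : ℝ} (hy : 0 < y) :
    ∃ q : ℝ, 0 < q ∧ q < 1 ∧ (y ^ 2 + 2) * q = 1 + q ^ 2 ∧ -Real.log q ≤ y := by
  set s := Real.arsinh (y / 2) with hs
  have hsinh : Real.sinh s = y / 2 := Real.sinh_arsinh _
  have hs0 : 0 < s := Real.arsinh_pos_iff.2 (by positivity)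
  have hle : s ≤ y / 2 := hsinh ▸ Real.self_le_sinh_iff.2 hs0.le
  -- The equation reads `q + q⁻¹ = 2 + y²`, and `2 cosh 2s = 2 + 4 sinh² s`; the logarithmic bound
  -- is `s ≤ sinh s`.
  refine ⟨Real.exp (-(2 * s)), Real.exp_pos _, Real.exp_lt_one_iff.2 (by linarith), ?_, ?_⟩
  · have hcosh : Real.cosh (2 * s) = 1 + y ^ 2 / 2 := by
      rw [Real.cosh_two_mul, Real.cosh_sq, hsinh]
      ring
    have hmul : Real.exp (2 * s) * Real.exp (-(2 * s)) = 1 := by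
      rw [← Real.exp_add, add_neg_cancel, Real.exp_zero]
    rw [Real.cosh_eq] at hcosh
    linear_combination (-2 * Real.exp (-(2 * s))) * hcosh + hmul
  · rw [Real.log_exp]
    linarith

end Geometric

/-! ### From the optimality gap to the number of rounds -/

section Rounds

theorem log_le_of_quad_gap {μ X ε q y : ℝ} {K : ℕ} (hμX : 0 < μ * X) (hε : 0 < ε)
    (hεa : ε ≤ 1 / 4 * (μ * X)) (hq : 0 < q) (hy : -Real.log q ≤ y)
    (hgap : μ / 2 * (q ^ (2 * K) * X) ≤ ε) : Real.log (μ * X / ε) ≤ 4 * K * y := by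
  have h1 : μ * X / ε * q ^ (2 * K) ≤ 2 := by
    rw [div_mul_eq_mul_div, div_le_iff₀ hε]
    linarith
  have hr : 0 < μ * X / ε := by positivity
  have h2 : Real.log (μ * X / ε) + 2 * K * Real.log q ≤ Real.log 2 := by
    have := Real.log_le_log (by positivity) h1
    rw [Real.log_mul hr.ne' (by positivity), Real.log_pow] at this
    push_cast at this
    exact this
  -- The hypothesis `ε ≤ μX/4` lets half of the logarithm absorb the loss `log 2`, at the price of
  -- doubling `2Ky`.
  have h3 : 2 * Real.log 2 ≤ Real.log (μ * X / ε) := by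
    have : Real.log ((2 : ℝ) ^ 2) ≤ Real.log (μ * X / ε) := by
      refine Real.log_le_log (by norm_num) ?_
      rw [le_div_iff₀ hε]
      linarith
    rwa [Real.log_pow] at this
  have h4 : (2 * K : ℝ) * -Real.log q ≤ 2 * K * y := mul_le_mul_of_nonneg_left hy (by positivity)
  linarith

theorem produces_chainLoss_rounds {k : ℕ} {μ γ y q : ℝ} (hμ : 0 < μ) (hγ : 0 < γ)
    (h0 : 0 < q) (h1 : q < 1) (hq : (μ + 2 * γ) * q = γ * (1 + q ^ 2)) (hy : -Real.log q ≤ y)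
    {ε : ℝ} (hε : 0 < ε) (hεa : ε ≤ 1 / 4 * (μ * ‖geomSeq q h0.le h1‖ ^ 2)) {N : ℕ}
    {x : Fin (4 * k + 2) → Ell2}
    (hx : Produces (SimpleGraph.pathGraph (4 * k + 2)) (chainLoss k μ γ (μ / γ + 1 - q)) N x)
    (hgap : ∀ i, avg (chainLoss k μ γ (μ / γ + 1 - q)) (x i)
      - avg (chainLoss k μ γ (μ / γ + 1 - q)) (geomSeq q h0.le h1) ≤ ε) :
    (2 * k + 1) * Real.log (μ * ‖geomSeq q h0.le h1‖ ^ 2 / ε) ≤ 8 * N * y := by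
  obtain ⟨K, hK, hlt⟩ := exists_bound_frontier (d := 2 * k + 1) (t := N) (by omega)
  -- The last agent is farthest from the linear term, so its support bound has no additive constant.
  let i : Fin (4 * k + 2) := ⟨4 * k + 1, by omega⟩
  have hpos : position k i = 2 * k + 1 := by
    change min (4 * k + 1 - k) (2 * k + 1) = 2 * k + 1
    omega
  have hmem := produces_chainLoss_mem hμ hγ.le hx i
  rw [hpos] at hmem
  have htail := pow_mul_norm_sq_le_norm_sub_geomSeq (q := q) (h0 := h0.le) (h1 := h1) (K := K)
    (x := x i) fun n hn => hmem n fun h => absurd (hlt n h) (not_lt.2 hn)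
  have hgrow := quad_add_le_of_apply_eq (chainOp_swap_isSymmetric μ γ γ)
    (mul_norm_sq_le_inner_chainOp hγ.le hγ.le)
    (chainOp_geomSeq (h0 := h0.le) (h1 := h1) hγ.ne' hq) (x i)
  have hi := hgap i
  rw [avg_chainLoss] at hi
  have hlog := log_le_of_quad_gap (K := K)
    (mul_pos hμ (pow_pos (norm_pos_iff.2 geomSeq_ne_zero) 2)) hε hεa h0 hy (by
      have := mul_le_mul_of_nonneg_left htail (by positivity : 0 ≤ μ / 2)
      linarith)
  have hy0 : 0 ≤ y := (neg_nonneg.2 (Real.log_nonpos h0.le h1.le)).trans hy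
  have hK' : (K : ℝ) * (2 * k + 1) ≤ 2 * N := by exact_mod_cast hK
  calc (2 * k + 1) * Real.log (μ * ‖geomSeq q h0.le h1‖ ^ 2 / ε)
      ≤ (2 * k + 1) * (4 * K * y) := by gcongr
    _ = 4 * y * (K * (2 * k + 1)) := by ring
    _ ≤ 4 * y * (2 * N) := by gcongr
    _ = 8 * N * y := by ring

end Rounds

end DistOpt

end

/-! ### Choice of the parameters -/

theorem mainTheorem3 :
    ∃ c > (0 : ℝ), ∃ a > (0 : ℝ),
      ∀ μ β ρ : ℝ, 0 < μ → μ < 1 → 0 < β → β < 1 → 0 ≤ ρ → ρ < 1 →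
        ∃ (m : ℕ) (G : SimpleGraph (Fin m)) (W : Matrix (Fin m) (Fin m) ℝ)
          (f : Fin m → DistOpt.Ell2 → ℝ) (xstar : DistOpt.Ell2),
          2 ≤ m ∧
          (G = SimpleGraph.pathGraph m ∨ (m = 3 ∧ G = ⊤)) ∧
          DistOpt.IsGossip G W ∧
          DistOpt.gossipParam W = ρ ∧
          DistOpt.ProblemClass μ 1 f ∧
          DistOpt.Similar β f ∧
          xstar ≠ 0 ∧
          IsMinOn (DistOpt.avg f) Set.univ xstar ∧
          ∀ ε : ℝ, 0 < ε → ε ≤ a * (μ * ‖xstar‖ ^ 2) →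
            ∀ (N : ℕ) (x : Fin m → DistOpt.Ell2),
              DistOpt.Produces G f N x →
              (∀ i, DistOpt.avg f (x i) - DistOpt.avg f xstar ≤ ε) →
              c * (Real.sqrt ((min β (1 - μ) / μ) / (1 - ρ)) *
                Real.log (μ * ‖xstar‖ ^ 2 / ε)) ≤ N := by
  refine ⟨1 / 1024, by norm_num, 1 / 4, by norm_num, fun μ β ρ hμ hμ1 hβ _ hρ hρ1 => ?_⟩
  obtain ⟨k, W, hW, hWρ, hk⟩ := DistOpt.exists_isGossip_pathGraph hρ hρ1
  set b := min β (1 - μ) with hb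
  have hb0 : 0 < b := lt_min hβ (by linarith)
  have hbβ : b ≤ β := min_le_left _ _
  have hbμ : b ≤ 1 - μ := min_le_right _ _
  -- Similarity needs `12γ ≤ β` and smoothness `μ + 4γ ≤ 1`; the denominator `16` meets both and is
  -- a square.
  obtain ⟨γ, hγ⟩ : ∃ γ, γ = b / 16 := ⟨_, rfl⟩
  have hγ0 : 0 < γ := by rw [hγ]; positivity
  set y := Real.sqrt (μ / γ) with hy
  have hy0 : 0 < y := Real.sqrt_pos.2 (by positivity)
  have hy2 : y ^ 2 = μ / γ := Real.sq_sqrt (by positivity)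
  obtain ⟨q, hq0, hq1, hq, hlog⟩ := DistOpt.exists_decay_rate hy0
  have hq' : (μ + 2 * γ) * q = γ * (1 + q ^ 2) := by
    rw [← hq, hy2]
    field_simp
  refine ⟨4 * k + 2, _, W, DistOpt.chainLoss k μ γ (μ / γ + 1 - q),
    DistOpt.geomSeq q hq0.le hq1, by omega, Or.inl rfl, hW, hWρ,
    DistOpt.problemClass_chainLoss k _ hμ hγ0.le (by linarith),
    DistOpt.similar_chainLoss k _ hγ0.le (by linarith), DistOpt.geomSeq_ne_zero,
    fun x _ => ?_, fun ε hε hεa N x hx hgap => ?_⟩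
  · have := DistOpt.quad_add_le_of_apply_eq (DistOpt.chainOp_swap_isSymmetric μ γ γ)
      (DistOpt.mul_norm_sq_le_inner_chainOp hγ0.le hγ0.le)
      (DistOpt.chainOp_geomSeq (h0 := hq0.le) (h1 := hq1) hγ0.ne' hq') x
    rw [Set.mem_ofPred_eq, DistOpt.avg_chainLoss]
    exact (le_add_of_nonneg_right (by positivity)).trans this
  · have hmain := DistOpt.produces_chainLoss_rounds hμ hγ0 hq0 hq1 hq' hlog hε hεa hx hgap
    set X := Real.log (μ * ‖DistOpt.geomSeq q hq0.le hq1‖ ^ 2 / ε)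
    set S := Real.sqrt (b / μ / (1 - ρ)) with hS
    have hρ' : 0 < 1 - ρ := by linarith
    have hS0 : 0 ≤ S := Real.sqrt_nonneg _
    have hd : (0 : ℝ) < 2 * k + 1 := by positivity
    -- The factors `b` and `μ` cancel, leaving `√(16/(1-ρ))`, and the path length was chosen with
    -- `1/(1-ρ) ≤ (32(2k+1))²`. Together with the factor `8` from the round count this gives `1024`.
    have hSy : S * y ≤ 128 * (2 * k + 1) := by
      rw [hS, hy, ← Real.sqrt_mul (by positivity)]
      refine Real.sqrt_le_iff.2 ⟨by positivity, ?_⟩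
      have : b / μ / (1 - ρ) * (μ / γ) = 16 / (1 - ρ) := by
        rw [hγ]
        field_simp
      rw [this, div_le_iff₀ hρ']
      linarith
    have h1 : (2 * k + 1) * (S * X) ≤ (2 * k + 1) * (1024 * N) := by
      calc (2 * k + 1) * (S * X) = S * ((2 * k + 1) * X) := by ring
        _ ≤ S * (8 * N * y) := by gcongr
        _ = 8 * N * (S * y) := by ring
        _ ≤ 8 * N * (128 * (2 * k + 1)) := by gcongr
        _ = (2 * k + 1) * (1024 * N) := by ring
    linarith [le_of_mul_le_mul_left h1 hd]
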